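/- Let $T>0$, and let $f\colon[0,T]\times\mathbb R^n\to\mathbb R$ be a $C^3$ function for which there are constants $a_0\ge 0$ and $c_0>0$ with $$\nabla_x f(t,x)\cdot x\ \ge\ c_0|x|^2-a_0\qquad\text{for all }(t,x)\in[0,T]\times\mathbb R^n .$$ Let $\tau\in[0,T]$ and let $\xi\in\mathbb R^n$ be a degenerate critical point of $f(\tau,\cdot)$, i.e. $\nabla_x f(\tau,\xi)=0$ and $\det\nabla_x^2 f(\tau,\xi)=0$, such that the Hessian matrix $\nabla_x^2 f(\tau,\xi)$ is positive semidefinite. Suppose that there is $\ell\in\mathbb R^n\setminus\{0\}$ with (a) $\ker\nabla_x^2 f(\tau,\xi)=\operatorname{span}(\ell)$; (c) $\sum_{i,j,k}f_{x_ix_jx_k}(\tau,\xi)\,\ell_i\ell_j\ell_k\neq 0$. Then, up to time translations, there is exactly one solution $w\not\equiv\xi$ of $$\dot w(s)=-\nabla_x f(\tau,w(s)),\qquad \lim_{s\to-\infty}w(s)=\xi .$$ More precisely, there is such a solution $w\colon\mathbb R\to\mathbb R^n$, and for every interval $I\subseteq\mathbb R$ unbounded below and every solution $v\colon I\to\mathbb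 R^n$ of this problem with $v\not\equiv\xi$ there is $c\in\mathbb R$ such that $v(s)=w(s+c)$ for all $s\in I$. -/

import Mathlib

open Set Filter Topology

noncomputable section

/-- The partial derivative `∂g/∂x_i` at `x`. -/
def partialD {n : ℕ} (i : Fin n) (g : EuclideanSpace ℝ (Fin n) → ℝ)
    (x : EuclideanSpace ℝ (Fin n)) : ℝ :=
  fderiv ℝ g x (EuclideanSpace.single i 1)

/-- The Hessian matrix `(∂²g/∂x_i∂x_j)` at `x`. -/
def hessianMatrix {n : ℕ} (g : EuclideanSpace ℝ (Fin n) → ℝ)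
    (x : EuclideanSpace ℝ (Fin n)) : Matrix (Fin n) (Fin n) ℝ :=
  Matrix.of fun i j => partialD i (partialD j g) x

/-- The cubic form `∑ (∂³g/∂x_i∂x_j∂x_k)(x) ℓ_i ℓ_j ℓ_k`. -/
def cubicTerm {n : ℕ} (g : EuclideanSpace ℝ (Fin n) → ℝ)
    (x l : EuclideanSpace ℝ (Fin n)) : ℝ :=
  ∑ i, ∑ j, ∑ k, partialD i (partialD j (partialD k g)) x * l i * l j * l k

/-- `f` is of class `C³` on `[0,T] × ℝⁿ` and
`∇ₓf(t,x) · x ≥ c₀|x|² - a₀` there, for some `a₀ ≥ 0` and `c₀ > 0`. Only the values of `f` at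
times in `[0,T]` are used. -/
def IsCoerciveC3 {n : ℕ} (T : ℝ) (f : ℝ → EuclideanSpace ℝ (Fin n) → ℝ) : Prop :=
  ContDiffOn ℝ 3 (fun p : ℝ × EuclideanSpace ℝ (Fin n) => f p.1 p.2) (Icc 0 T ×ˢ univ) ∧
    ∃ a₀ c₀ : ℝ, 0 ≤ a₀ ∧ 0 < c₀ ∧ ∀ t ∈ Icc 0 T, ∀ x : EuclideanSpace ℝ (Fin n),
      c₀ * ‖x‖ ^ 2 - a₀ ≤ inner ℝ (gradient (f t) x) x

/-- The set `Z_f` of pairs `(t,ξ)`, `t ∈ [0,T]`, such that `ξ` is a degenerate critical point of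
`f(t,·)`. -/
def degenerateSet {n : ℕ} (T : ℝ) (f : ℝ → EuclideanSpace ℝ (Fin n) → ℝ) :
    Set (ℝ × EuclideanSpace ℝ (Fin n)) :=
  {p | p.1 ∈ Icc 0 T ∧ gradient (f p.1) p.2 = 0 ∧ (hessianMatrix (f p.1) p.2).det = 0}

/-- `w` is a nontrivial solution on the time interval `I` (unbounded below) of
`ẇ = -∇g(w)` with `w(s) → ξ` as `s → -∞`; nontrivial means different from the
equilibrium solution `w ≡ ξ`. -/
structure IsSolutionIssuingFrom {n : ℕ} (g : EuclideanSpace ℝ (Fin n) → ℝ)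
    (ξ : EuclideanSpace ℝ (Fin n)) (I : Set ℝ) (w : ℝ → EuclideanSpace ℝ (Fin n)) : Prop where
  ordConnected : I.OrdConnected
  not_bddBelow : ¬ BddBelow I
  ode : ∀ s ∈ I, HasDerivWithinAt w (-gradient g (w s)) I s
  tendsto : Tendsto w atBot (𝓝 ξ)
  nontrivial : ∃ s ∈ I, w s ≠ ξ

end

/-! Put F = -∇f(τ,·) and let e be the unit vector on the line of ℓ along which the cubic form of f
is negative. At ξ the linearization of F vanishes along e and is negative definite on the orthogonal
complement of e, while the second derivative pushes in the direction +e on both sides of ξ: the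
coordinate y = ⟨e, x - ξ⟩ satisfies roughly y' ≥ c y². A solution can therefore leave ξ only on the
side y > 0. No center manifold is constructed; a cone argument replaces it.

Outside a thin cone around e the transversal contraction dominates, so `coneForm` of a difference of
two solutions does not increase while it is positive (`IsConeField.coneForm_sub_le_max`). For two
solutions issuing from ξ it tends to 0 at -∞, hence their difference always lies in the cone.

Existence (`IsConeField.exists_entire_solution`): solutions started at ξ + ηe stay in the cone and
reach y = r/2 after a time that tends to infinity as η → 0; shifted to arrive at time 0, they
subconverge to a solution issuing from ξ. Coercivity makes it global forward in time.

Uniqueness (`IsConeField.exists_eq_translate`): after a time shift two solutions have the same y at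
some time; their difference is in the cone and orthogonal to e, hence zero. `exists_isConeField`
derives the cone conditions from Taylor expansion at ξ. -/

section

/-! ### Scalar comparison, and flows of Lipschitz fields -/

variable {E : Type*} [NormedAddCommGroup E] [InnerProductSpace ℝ E]

/-- A real function whose derivative is nonpositive wherever the function is positive satisfies
`U b ≤ max (U a) 0`. -/
theorem le_max_zero_of_deriv_nonpos_of_pos {U U' : ℝ → ℝ} {a b : ℝ} (hab : a ≤ b)
    (hU : ∀ x ∈ Icc a b, HasDerivWithinAt U (U' x) (Icc a b) x)
    (h : ∀ x ∈ Icc a b, 0 < U x → U' x ≤ 0) : U b ≤ max (U a) 0 := by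
  have hcont : ContinuousOn U (Icc a b) := fun x hx => (hU x hx).continuousWithinAt
  -- The barrier is positive and has slope ε; where U touches it, U > 0, so U' ≤ 0 < ε.
  have key : ∀ ε > 0, U b ≤ max (U a) 0 + ε * (1 + (b - a)) := by
    intro ε hε
    refine image_le_of_deriv_right_lt_deriv_boundary (B := fun x => max (U a) 0 + ε * (1 + (x - a)))
      (B' := fun _ => ε) hcont
      (fun x hx => (hU x (Ico_subset_Icc_self hx)).mono_of_mem_nhdsWithin
        (Icc_mem_nhdsGE_of_mem hx)) ?_ ?_ ?_ (right_mem_Icc.2 hab)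
    · have := le_max_left (U a) 0
      simp only [sub_self, add_zero, mul_one]
      linarith
    · intro x
      simpa using ((((hasDerivAt_id x).sub_const a).const_add 1).const_mul ε).const_add
        (max (U a) 0)
    · intro x hx hxB
      have h1 : 0 < U x := by
        have : 0 ≤ max (U a) 0 := le_max_right _ _
        have : 0 < ε * (1 + (x - a)) := mul_pos hε (by linarith [hx.1])
        rw [hxB]; linarith
      exact (h x (Ico_subset_Icc_self hx) h1).trans_lt hε
  have hlim : Tendsto (fun ε : ℝ => max (U a) 0 + ε * (1 + (b - a))) (𝓝[>] 0)
      (𝓝 (max (U a) 0)) := by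
    have : Continuous (fun ε : ℝ => max (U a) 0 + ε * (1 + (b - a))) := by fun_prop
    simpa using (this.tendsto 0).mono_left nhdsWithin_le_nhds
  exact ge_of_tendsto hlim (eventually_mem_nhdsWithin.mono fun ε hε => key ε hε)

/-- A `C¹` vector field on a finite dimensional space is Lipschitz on each closed ball. -/
theorem exists_lipschitzOnWith_closedBall [FiniteDimensional ℝ E] {F : E → E}
    (hF : ContDiff ℝ 1 F) (R : ℝ) : ∃ K, LipschitzOnWith K F (Metric.closedBall 0 R) := by
  have hc : IsCompact (Metric.closedBall (0 : E) R) := isCompact_closedBall 0 R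
  obtain ⟨C, hC⟩ := hc.exists_bound_of_continuousOn (hF.continuous_fderiv one_ne_zero).continuousOn
  refine ⟨C.toNNReal, (convex_closedBall 0 R).lipschitzOnWith_of_nnnorm_fderiv_le (𝕜 := ℝ)
    (fun x _ => (hF.differentiable one_ne_zero) x) fun x hx => ?_⟩
  rw [← NNReal.coe_le_coe]
  exact (hC x hx).trans (Real.le_coe_toNNReal C)

/-- Uniqueness for the autonomous equation `v' = F v` with a `C¹` field, on any interval. -/
theorem eqOn_of_hasDerivWithinAt_of_eq [FiniteDimensional ℝ E] {F : E → E} (hF : ContDiff ℝ 1 F)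
    {I : Set ℝ} (hI : I.OrdConnected) {v w : ℝ → E}
    (hv : ∀ s ∈ I, HasDerivWithinAt v (F (v s)) I s)
    (hw : ∀ s ∈ I, HasDerivWithinAt w (F (w s)) I s)
    {s₀ : ℝ} (hs₀ : s₀ ∈ I) (h : v s₀ = w s₀) : EqOn v w I := by
  have bound : ∀ a b, a ∈ I → b ∈ I → ∃ R : ℝ, ∀ t ∈ Icc a b,
      v t ∈ Metric.closedBall 0 R ∧ w t ∈ Metric.closedBall 0 R := by
    intro a b ha hb
    have hsub : Icc a b ⊆ I := hI.out ha hb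
    obtain ⟨C, hC⟩ := isCompact_Icc.exists_bound_of_continuousOn
      (fun s hs => ((hv s (hsub hs)).continuousWithinAt.mono hsub) : ContinuousOn v (Icc a b))
    obtain ⟨D, hD⟩ := isCompact_Icc.exists_bound_of_continuousOn
      (fun s hs => ((hw s (hsub hs)).continuousWithinAt.mono hsub) : ContinuousOn w (Icc a b))
    exact ⟨max C D, fun t ht => ⟨mem_closedBall_zero_iff.2 ((hC t ht).trans (le_max_left _ _)),
      mem_closedBall_zero_iff.2 ((hD t ht).trans (le_max_right _ _))⟩⟩
  intro t ht
  rcases le_total s₀ t with hst | hst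
  · obtain ⟨R, hR⟩ := bound s₀ t hs₀ ht
    obtain ⟨K, hK⟩ := exists_lipschitzOnWith_closedBall hF R
    have hsub : Icc s₀ t ⊆ I := hI.out hs₀ ht
    exact ODE_solution_unique_of_mem_Icc_right (v := fun _ => F)
      (s := fun _ => Metric.closedBall 0 R) (fun _ _ => hK)
      (fun s hs => (hv s (hsub hs)).continuousWithinAt.mono hsub)
      (fun s hs => ((hv s (hsub (Ico_subset_Icc_self hs))).mono hsub).mono_of_mem_nhdsWithin
        (Icc_mem_nhdsGE_of_mem hs))
      (fun s hs => (hR s (Ico_subset_Icc_self hs)).1)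
      (fun s hs => (hw s (hsub hs)).continuousWithinAt.mono hsub)
      (fun s hs => ((hw s (hsub (Ico_subset_Icc_self hs))).mono hsub).mono_of_mem_nhdsWithin
        (Icc_mem_nhdsGE_of_mem hs))
      (fun s hs => (hR s (Ico_subset_Icc_self hs)).2) h (right_mem_Icc.2 hst)
  · obtain ⟨R, hR⟩ := bound t s₀ ht hs₀
    obtain ⟨K, hK⟩ := exists_lipschitzOnWith_closedBall hF R
    have hsub : Icc t s₀ ⊆ I := hI.out ht hs₀
    exact ODE_solution_unique_of_mem_Icc_left (v := fun _ => F)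
      (s := fun _ => Metric.closedBall 0 R) (fun _ _ => hK)
      (fun s hs => (hv s (hsub hs)).continuousWithinAt.mono hsub)
      (fun s hs => ((hv s (hsub (Ioc_subset_Icc_self hs))).mono hsub).mono_of_mem_nhdsWithin
        (Icc_mem_nhdsLE_of_mem hs))
      (fun s hs => (hR s (Ioc_subset_Icc_self hs)).1)
      (fun s hs => (hw s (hsub hs)).continuousWithinAt.mono hsub)
      (fun s hs => ((hw s (hsub (Ioc_subset_Icc_self hs))).mono hsub).mono_of_mem_nhdsWithin
        (Icc_mem_nhdsLE_of_mem hs))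
      (fun s hs => (hR s (Ioc_subset_Icc_self hs)).2) h (left_mem_Icc.2 hst)

/-- A bounded globally Lipschitz vector field has global integral curves. -/
theorem exists_global_solution [CompleteSpace E] {G : E → E} {K : NNReal}
    (hG : LipschitzWith K G) {C : NNReal} (hC : ∀ x, ‖G x‖ ≤ C) (x₀ : E) :
    ∃ γ : ℝ → E, γ 0 = x₀ ∧ ∀ t, HasDerivAt γ (G (γ t)) t := by
  have loc : ∀ N : ℕ, ∃ α : ℝ → E, α 0 = x₀ ∧
      ∀ t ∈ Ioo (-(N : ℝ)) N, HasDerivAt α (G (α t)) t := by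
    intro N
    have h0 : (0 : ℝ) ∈ Icc (-(N : ℝ)) N := by simp
    -- Since the field is bounded by C everywhere, a ball of radius C * N suffices for time N,
    -- whatever N is.
    have hpl : IsPicardLindelof (fun _ => G) (tmin := -(N : ℝ)) (tmax := N) ⟨0, h0⟩ x₀
        (C * N) 0 C K :=
      { lipschitzOnWith := fun t _ => hG.lipschitzOnWith
        continuousOn := fun x _ => continuousOn_const
        norm_le := fun t _ x _ => hC x
        mul_max_le := by simp }
    obtain ⟨α, h1, h2⟩ := hpl.exists_eq_forall_mem_Icc_hasDerivWithinAt₀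
    exact ⟨α, h1, fun t ht => (h2 t (Ioo_subset_Icc_self ht)).hasDerivAt (Icc_mem_nhds ht.1 ht.2)⟩
  choose α hα0 hα using loc
  have agree : ∀ N M : ℕ, N ≤ M → EqOn (α N) (α M) (Ioo (-(N : ℝ)) N) := by
    intro N M hNM t ht
    have hNM' : (N : ℝ) ≤ M := by exact_mod_cast hNM
    have hN : (0 : ℝ) < N := by linarith [ht.1, ht.2]
    exact ODE_solution_unique_of_mem_Ioo (v := fun _ => G) (s := fun _ => univ) (t₀ := 0)
      (fun _ _ => hG.lipschitzOnWith) (by constructor <;> linarith)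
      (fun s hs => ⟨hα N s hs, mem_univ _⟩)
      (fun s hs => ⟨hα M s ⟨by linarith [hs.1], by linarith [hs.2]⟩, mem_univ _⟩)
      (by rw [hα0, hα0]) ht
  -- The added 1 puts t strictly inside the open interval of index `idx t`.
  let idx : ℝ → ℕ := fun t => ⌈|t|⌉₊ + 1
  have hidx : ∀ t : ℝ, |t| < idx t := fun t => by
    have := Nat.le_ceil |t|
    simp only [idx]; push_cast; linarith
  have hγ : ∀ (N : ℕ) (t : ℝ), |t| < N → α (idx t) t = α N t := by
    intro N t ht
    rcases le_total (idx t) N with h | h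
    · exact agree _ _ h (abs_lt.1 (hidx t))
    · exact (agree _ _ h (abs_lt.1 ht)).symm
  refine ⟨fun t => α (idx t) t, hα0 _, fun t => ?_⟩
  have hder := hα (idx t) t (abs_lt.1 (hidx t))
  refine hder.congr_of_eventuallyEq ?_
  filter_upwards [(continuous_abs.tendsto t).eventually (gt_mem_nhds (hidx t))] with s hs
  exact hγ _ s hs

/-- Two global integral curves of a `K`-Lipschitz field diverge at most like `exp (K |t|)`, forward
and backward in time. -/
theorem dist_le_of_global_solutions {G : E → E} {K : NNReal} (hG : LipschitzWith K G)
    {u v : ℝ → E} (hu : ∀ t, HasDerivAt u (G (u t)) t) (hv : ∀ t, HasDerivAt v (G (v t)) t)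
    (t : ℝ) : dist (u t) (v t) ≤ dist (u 0) (v 0) * Real.exp (K * |t|) := by
  rcases le_total 0 t with ht | ht
  · have := dist_le_of_trajectories_ODE (v := fun _ => G) (fun _ => hG) (a := 0) (b := t)
      (fun s _ => (hu s).continuousAt.continuousWithinAt) (fun s _ => (hu s).hasDerivWithinAt)
      (fun s _ => (hv s).continuousAt.continuousWithinAt) (fun s _ => (hv s).hasDerivWithinAt)
      le_rfl t (right_mem_Icc.2 ht)
    simpa [abs_of_nonneg ht] using this
  · have hu' : ∀ s, HasDerivAt (fun s => u (-s)) (-G (u (-s))) s := fun s => by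
      simpa [Function.comp_def] using (hu (-s)).scomp s (hasDerivAt_neg s)
    have hv' : ∀ s, HasDerivAt (fun s => v (-s)) (-G (v (-s))) s := fun s => by
      simpa [Function.comp_def] using (hv (-s)).scomp s (hasDerivAt_neg s)
    have := dist_le_of_trajectories_ODE (v := fun _ x => -G x) (fun _ => hG.neg) (a := 0) (b := -t)
      (fun s _ => (hu' s).continuousAt.continuousWithinAt) (fun s _ => (hu' s).hasDerivWithinAt)
      (fun s _ => (hv' s).continuousAt.continuousWithinAt) (fun s _ => (hv' s).hasDerivWithinAt)
      le_rfl (-t) (right_mem_Icc.2 (by linarith))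
    simpa [abs_of_nonpos ht] using this

end

/-! ### Cone fields and forward invariance of the cone -/

section

variable {E : Type*} [NormedAddCommGroup E] [InnerProductSpace ℝ E]

/-- The quadratic form `‖u‖² - κ ⟨e, u⟩²`; for `‖e‖ = 1` it is nonpositive exactly on a double cone
around the line spanned by `e`. -/
def coneForm (e : E) (κ : ℝ) (u : E) : ℝ := ‖u‖ ^ 2 - κ * (inner ℝ e u) ^ 2

/-- Near its zero `ξ` the field `F` contracts outside the cones of `coneForm e κ`, and drifts in
the direction `e` inside the cone at `ξ`. -/
structure IsConeField (F : E → E) (ξ e : E) (κ r c : ℝ) : Prop where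
  norm_eq_one : ‖e‖ = 1
  one_le : 1 ≤ κ
  le_two : κ ≤ 2
  radius_pos : 0 < r
  drift_pos : 0 < c
  apply_eq_zero : F ξ = 0
  contract : ∀ x ∈ Metric.ball ξ r, ∀ y ∈ Metric.ball ξ r, 0 < coneForm e κ (x - y) →
    inner ℝ (x - y) (F x - F y) - κ * (inner ℝ e (x - y) * inner ℝ e (F x - F y)) ≤ 0
  drift : ∀ x ∈ Metric.ball ξ r, coneForm e κ (x - ξ) ≤ 0 →
    c * (inner ℝ e (x - ξ)) ^ 2 ≤ inner ℝ e (F x)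

theorem continuous_coneForm (e : E) (κ : ℝ) : Continuous (coneForm e κ) := by
  unfold coneForm; fun_prop

@[simp]
theorem coneForm_zero (e : E) (κ : ℝ) : coneForm e κ 0 = 0 := by simp [coneForm]

/-- When u is a difference of two solutions, half of this derivative is the quantity bounded in
`IsConeField.contract`. -/
theorem hasDerivWithinAt_coneForm {e : E} {κ : ℝ} {u : ℝ → E} {u' : E} {I : Set ℝ} {s : ℝ}
    (hu : HasDerivWithinAt u u' I s) :
    HasDerivWithinAt (fun t => coneForm e κ (u t))
      (2 * (inner ℝ (u s) u' - κ * (inner ℝ e (u s) * inner ℝ e u'))) I s := by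
  have h1 := hu.norm_sq
  have h2 : HasDerivWithinAt (fun t => inner ℝ e (u t)) (inner ℝ e u') I s := by
    simpa using (hasDerivWithinAt_const s I e).inner ℝ hu
  have h3 := h1.sub ((h2.pow 2).const_mul κ)
  unfold coneForm
  convert! h3 using 1
  push_cast
  ring

namespace IsConeField

variable {F : E → E} {ξ e : E} {κ r c : ℝ}

theorem norm_sq_le (h : IsConeField F ξ e κ r c) {u : E} (hu : coneForm e κ u ≤ 0) :
    ‖u‖ ^ 2 ≤ 2 * (inner ℝ e u) ^ 2 := by
  have := mul_le_mul_of_nonneg_right h.le_two (sq_nonneg (inner ℝ e u))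
  unfold coneForm at hu
  linarith

/-- Applied to a difference of solutions, this reduces uniqueness to matching a single scalar
coordinate. -/
theorem eq_zero_of_inner_eq_zero (h : IsConeField F ξ e κ r c) {u : E}
    (hu : coneForm e κ u ≤ 0) (h0 : inner ℝ e u = 0) : u = 0 := by
  have := h.norm_sq_le hu
  rw [h0] at this
  have : ‖u‖ ^ 2 = 0 := le_antisymm (by simpa using this) (sq_nonneg _)
  simpa using this

/-- In the cone ‖x - ξ‖² ≤ 2(r/2)² < r², so the level r/2 keeps solutions where the local estimates
hold. -/
theorem mem_ball (h : IsConeField F ξ e κ r c) {x : E} (hx : coneForm e κ (x - ξ) ≤ 0)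
    (hy : |inner ℝ e (x - ξ)| ≤ r / 2) : x ∈ Metric.ball ξ r := by
  have h1 := h.norm_sq_le hx
  have h2 : (inner ℝ e (x - ξ)) ^ 2 ≤ (r / 2) ^ 2 := sq_le_sq' (abs_le.1 hy).1 (abs_le.1 hy).2
  have hr := h.radius_pos
  rw [mem_ball_iff_norm]
  refine lt_of_pow_lt_pow_left₀ 2 hr.le ?_
  nlinarith

/-- The cone condition on differences of solutions is preserved forward in time. -/
theorem coneForm_sub_le_max (h : IsConeField F ξ e κ r c) {u v : ℝ → E} {a b : ℝ} (hab : a ≤ b)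
    (hu : ∀ s ∈ Icc a b, HasDerivWithinAt u (F (u s)) (Icc a b) s)
    (hv : ∀ s ∈ Icc a b, HasDerivWithinAt v (F (v s)) (Icc a b) s)
    (hur : ∀ s ∈ Icc a b, u s ∈ Metric.ball ξ r) (hvr : ∀ s ∈ Icc a b, v s ∈ Metric.ball ξ r) :
    coneForm e κ (u b - v b) ≤ max (coneForm e κ (u a - v a)) 0 :=
  le_max_zero_of_deriv_nonpos_of_pos (U := fun s => coneForm e κ (u s - v s)) hab
    (fun s hs => hasDerivWithinAt_coneForm ((hu s hs).sub (hv s hs))) fun s hs hpos => by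
      have := h.contract _ (hur s hs) _ (hvr s hs) hpos
      linarith

theorem coneForm_sub_center_le_max (h : IsConeField F ξ e κ r c) {u : ℝ → E} {a b : ℝ}
    (hab : a ≤ b) (hu : ∀ s ∈ Icc a b, HasDerivWithinAt u (F (u s)) (Icc a b) s)
    (hur : ∀ s ∈ Icc a b, u s ∈ Metric.ball ξ r) :
    coneForm e κ (u b - ξ) ≤ max (coneForm e κ (u a - ξ)) 0 :=
  h.coneForm_sub_le_max (v := fun _ => ξ) hab hu
    (fun s _ => by rw [h.apply_eq_zero]; exact hasDerivWithinAt_const _ _ _) hur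
    fun _ _ => Metric.mem_ball_self h.radius_pos

/-- Two solutions issuing from `ξ` at `-∞` differ by a vector in the cone. -/
theorem coneForm_sub_nonpos_of_tendsto (h : IsConeField F ξ e κ r c) {u v : ℝ → E} {s₀ : ℝ}
    (hu : ∀ s ∈ Iic s₀, HasDerivWithinAt u (F (u s)) (Iic s₀) s)
    (hv : ∀ s ∈ Iic s₀, HasDerivWithinAt v (F (v s)) (Iic s₀) s)
    (hur : ∀ s ∈ Iic s₀, u s ∈ Metric.ball ξ r) (hvr : ∀ s ∈ Iic s₀, v s ∈ Metric.ball ξ r)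
    (hul : Tendsto u atBot (𝓝 ξ)) (hvl : Tendsto v atBot (𝓝 ξ)) :
    coneForm e κ (u s₀ - v s₀) ≤ 0 := by
  have hlim : Tendsto (fun s => max (coneForm e κ (u s - v s)) 0) atBot (𝓝 0) := by
    have h1 := ((continuous_coneForm e κ).tendsto _).comp (hul.sub hvl)
    simpa using h1.max (tendsto_const_nhds (x := (0 : ℝ)))
  refine ge_of_tendsto hlim ((eventually_le_atBot s₀).mono fun s hs => ?_)
  exact h.coneForm_sub_le_max hs (fun t ht => (hu t ht.2).mono Icc_subset_Iic_self)
    (fun t ht => (hv t ht.2).mono Icc_subset_Iic_self) (fun t ht => hur t ht.2)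
    (fun t ht => hvr t ht.2)

/-- Growth of the coordinate along `e` for a solution inside the cone. -/
theorem inner_add_le (h : IsConeField F ξ e κ r c) {u : ℝ → E} {a b m : ℝ} (hab : a ≤ b)
    (hu : ∀ s ∈ Icc a b, HasDerivWithinAt u (F (u s)) (Icc a b) s)
    (hur : ∀ s ∈ Icc a b, u s ∈ Metric.ball ξ r)
    (hcone : ∀ s ∈ Icc a b, coneForm e κ (u s - ξ) ≤ 0)
    (hm : ∀ s ∈ Icc a b, m ≤ (inner ℝ e (u s - ξ)) ^ 2) :
    inner ℝ e (u a - ξ) + c * m * (b - a) ≤ inner ℝ e (u b - ξ) := by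
  have key := le_max_zero_of_deriv_nonpos_of_pos
    (U := fun s => inner ℝ e (u a - ξ) + c * m * (s - a) - inner ℝ e (u s - ξ))
    (U' := fun s => c * m - inner ℝ e (F (u s))) hab (fun s hs => ?_) (fun s hs _ => ?_)
  · simp only [sub_self, mul_zero, add_zero, max_self] at key
    linarith
  · have h2 : HasDerivWithinAt (fun t => inner ℝ e (u t - ξ)) (inner ℝ e (F (u s))) (Icc a b) s := by
      simpa using (hasDerivWithinAt_const s (Icc a b) e).inner ℝ ((hu s hs).sub_const ξ)
    have h1 : HasDerivWithinAt (fun t => inner ℝ e (u a - ξ) + c * m * (t - a)) (c * m)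
        (Icc a b) s := by
      simpa using ((((hasDerivAt_id s).sub_const a).const_mul (c * m)).const_add
        (inner ℝ e (u a - ξ))).hasDerivWithinAt
    exact h1.sub h2
  · have h1 := h.drift _ (hur s hs) (hcone s hs)
    have h2 := mul_le_mul_of_nonneg_left (hm s hs) h.drift_pos.le
    linarith

/-- A solution starting in the direction `e` stays in the cone, with increasing coordinate along
`e`, as long as that coordinate is at most `r / 2`. -/
theorem mem_cone_of_inner_le (h : IsConeField F ξ e κ r c) {u : ℝ → E} {t₁ η : ℝ} (hη : 0 < η)
    (hu : ∀ s, u s ∈ Metric.ball ξ r → HasDerivAt u (F (u s)) s) (huc : Continuous u)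
    (hu0 : u 0 = ξ + η • e) (hle : ∀ t ∈ Icc 0 t₁, inner ℝ e (u t - ξ) ≤ r / 2) :
    ∀ t ∈ Icc 0 t₁, coneForm e κ (u t - ξ) ≤ 0 ∧ η ≤ inner ℝ e (u t - ξ) := by
  have hcl : IsClosed {t | coneForm e κ (u t - ξ) ≤ 0 ∧ η ≤ inner ℝ e (u t - ξ)} := by
    have h1 : Continuous fun t => inner ℝ e (u t - ξ) := by fun_prop
    exact (isClosed_le ((continuous_coneForm e κ).comp (huc.sub continuous_const))
      continuous_const).inter (isClosed_le continuous_const h1)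
  -- Continuous induction: the good times form a closed set, and from a good time the solution stays
  -- in the ball a little longer, where the cone is preserved and the coordinate does not decrease.
  refine (hcl.inter isClosed_Icc).Icc_subset_of_forall_exists_gt ?_ ?_
  · have h1 : inner ℝ e (u 0 - ξ) = η := by
      rw [hu0, add_sub_cancel_left, inner_smul_right, real_inner_self_eq_norm_sq, h.norm_eq_one]
      simp
    refine ⟨?_, h1.ge⟩
    unfold coneForm
    rw [h1, hu0, add_sub_cancel_left, norm_smul, h.norm_eq_one, mul_one, Real.norm_eq_abs, sq_abs]
    nlinarith [h.one_le, sq_nonneg η]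
  · rintro x ⟨⟨hx1, hx2⟩, hx⟩ y (hxy : x < y)
    have hxb : u x ∈ Metric.ball ξ r := h.mem_ball hx1
      (abs_le.2 ⟨by linarith [h.radius_pos], hle x (Ico_subset_Icc_self hx)⟩)
    obtain ⟨ε, hε, hball⟩ := Metric.isOpen_iff.1 (Metric.isOpen_ball.preimage huc) x hxb
    set z := min (x + ε / 2) y with hz
    have hxz : x < z := lt_min (by linarith) hxy
    have hin : ∀ t ∈ Icc x z, u t ∈ Metric.ball ξ r := fun t ht => hball (by
      rw [Metric.mem_ball, Real.dist_eq, abs_lt]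
      have := ht.2.trans (min_le_left _ _)
      constructor <;> linarith [ht.1])
    have hcone : ∀ t ∈ Icc x z, coneForm e κ (u t - ξ) ≤ 0 := fun t ht => by
      have hsub : Icc x t ⊆ Icc x z := Icc_subset_Icc_right ht.2
      have := h.coneForm_sub_center_le_max ht.1
        (fun s hs => (hu s (hin s (hsub hs))).hasDerivWithinAt) (fun s hs => hin s (hsub hs))
      rwa [max_eq_right hx1] at this
    refine ⟨z, ⟨hcone z (right_mem_Icc.2 hxz.le), ?_⟩, hxz, min_le_right _ _⟩
    have := h.inner_add_le (m := 0) hxz.le (fun s hs => (hu s (hin s hs)).hasDerivWithinAt) hin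
      hcone (fun s _ => sq_nonneg _)
    simp only [mul_zero, zero_mul, add_zero] at this
    exact hx2.trans this

/-- A solution starting at `ξ + η • e` reaches the level `r / 2` of the coordinate along `e`,
inside the cone. -/
theorem exists_time_inner_eq (h : IsConeField F ξ e κ r c) {u : ℝ → E} {η : ℝ} (hη : 0 < η)
    (hηr : η ≤ r / 2)
    (hu : ∀ s, u s ∈ Metric.ball ξ r → HasDerivAt u (F (u s)) s) (huc : Continuous u)
    (hu0 : u 0 = ξ + η • e) :
    ∃ t₁, 0 ≤ t₁ ∧ inner ℝ e (u t₁ - ξ) = r / 2 ∧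
      ∀ t ∈ Icc 0 t₁, coneForm e κ (u t - ξ) ≤ 0 ∧ 0 ≤ inner ℝ e (u t - ξ) ∧
        inner ℝ e (u t - ξ) ≤ r / 2 := by
  have hyc : Continuous fun t => inner ℝ e (u t - ξ) := by fun_prop
  have hy0 : inner ℝ e (u 0 - ξ) = η := by
    rw [hu0, add_sub_cancel_left, inner_smul_right, real_inner_self_eq_norm_sq, h.norm_eq_one]
    simp
  have hc := h.drift_pos
  have hex : ∃ T, 0 ≤ T ∧ r / 2 ≤ inner ℝ e (u T - ξ) := by
    by_contra! hcon
    -- The coordinate stays above η, so its speed is at least c η², which gains r/2 by this time.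
    set T := (r / 2) / (c * η ^ 2) with hT
    have hr := h.radius_pos
    have hT0 : 0 ≤ T := by positivity
    have hle : ∀ t ∈ Icc 0 T, inner ℝ e (u t - ξ) ≤ r / 2 := fun t ht => (hcon t ht.1).le
    have hcone := h.mem_cone_of_inner_le hη hu huc hu0 hle
    have hin : ∀ t ∈ Icc 0 T, u t ∈ Metric.ball ξ r := fun t ht => h.mem_ball (hcone t ht).1
      (abs_le.2 ⟨by linarith [(hcone t ht).2], hle t ht⟩)
    have := h.inner_add_le (m := η ^ 2) hT0 (fun s hs => (hu s (hin s hs)).hasDerivWithinAt) hin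
      (fun s hs => (hcone s hs).1) (fun s hs => pow_le_pow_left₀ hη.le (hcone s hs).2 2)
    have h2 : c * η ^ 2 * (T - 0) = r / 2 := by rw [hT]; field_simp; ring
    rw [h2, hy0] at this
    linarith [hcon T hT0]
  obtain ⟨T, hT0, hT⟩ := hex
  -- The least element of this compact set is the first time at which the level r/2 is reached.
  have hcomp : IsCompact (Icc 0 T ∩ {t | r / 2 ≤ inner ℝ e (u t - ξ)}) :=
    isCompact_Icc.inter_right (isClosed_le continuous_const hyc)
  obtain ⟨t₁, ⟨ht₁, ht₁' : r / 2 ≤ _⟩, hleast⟩ := hcomp.exists_isLeast ⟨T, ⟨hT0, le_rfl⟩, hT⟩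
  have hlt : ∀ t ∈ Ico 0 t₁, inner ℝ e (u t - ξ) < r / 2 := by
    intro t ht
    by_contra! hcon
    exact absurd (hleast ⟨⟨ht.1, ht.2.le.trans ht₁.2⟩, hcon⟩) (not_le.2 ht.2)
  have heq : inner ℝ e (u t₁ - ξ) = r / 2 := by
    obtain ⟨s, hs, hs'⟩ := intermediate_value_Icc ht₁.1 hyc.continuousOn
      (show r / 2 ∈ Icc _ _ from ⟨by simpa only [hy0] using hηr, ht₁'⟩)
    rcases hs.2.eq_or_lt with h1 | h1
    · rw [← h1]; exact hs'
    · exact absurd hs' (hlt s ⟨hs.1, h1⟩).ne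
  have hle : ∀ t ∈ Icc 0 t₁, inner ℝ e (u t - ξ) ≤ r / 2 := by
    intro t ht
    rcases ht.2.eq_or_lt with h1 | h1
    · rw [h1]; exact heq.le
    · exact (hlt t ⟨ht.1, h1⟩).le
  refine ⟨t₁, ht₁.1, heq, fun t ht => ?_⟩
  have := h.mem_cone_of_inner_le hη hu huc hu0 hle t ht
  exact ⟨this.1, hη.le.trans this.2, hle t ht⟩

end IsConeField

end

/-! ### Existence and uniqueness of the solution issuing from ξ -/

section

variable {E : Type*} [NormedAddCommGroup E] [InnerProductSpace ℝ E]

/-- A `C¹` field can be truncated to a bounded Lipschitz field, without changing it on a given ball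
and only rescaling it by nonnegative factors elsewhere. -/
theorem exists_bounded_lipschitz_truncation [FiniteDimensional ℝ E] {F : E → E}
    (hF : ContDiff ℝ 1 F) {R : ℝ} (hR : 0 < R) :
    ∃ (G : E → E) (K C : NNReal), LipschitzWith K G ∧ (∀ x, ‖G x‖ ≤ C) ∧
      (∀ x ∈ Metric.closedBall 0 R, G x = F x) ∧ ∀ x, ∃ a : ℝ, 0 ≤ a ∧ G x = a • F x := by
  let χ : ContDiffBump (0 : E) := ⟨R, R + 1, hR, by linarith⟩
  have hG : ContDiff ℝ 1 fun x => χ x • F x := χ.contDiff.smul hF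
  have hs : HasCompactSupport fun x => χ x • F x := χ.hasCompactSupport.smul_right
  obtain ⟨K, hK⟩ := hG.lipschitzWith_of_hasCompactSupport hs one_ne_zero
  obtain ⟨C, hC⟩ := hs.exists_bound_of_continuous hG.continuous
  refine ⟨_, K, C.toNNReal, hK, fun x => (hC x).trans (Real.le_coe_toNNReal C), fun x hx => ?_,
    fun x => ⟨χ x, χ.nonneg, rfl⟩⟩
  simp only [χ.one_of_mem_closedBall hx, one_smul]

/-- A ball outside of which the field points inwards is forward invariant. -/
theorem norm_le_of_inner_nonpos {G : E → E} {R : ℝ}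
    (hG : ∀ x, R ≤ ‖x‖ → inner ℝ x (G x) ≤ 0) {u : ℝ → E} (hu : ∀ t, HasDerivAt u (G (u t)) t)
    (hR : 0 ≤ R) (h0 : ‖u 0‖ ≤ R) {t : ℝ} (ht : 0 ≤ t) : ‖u t‖ ≤ R := by
  have key := le_max_zero_of_deriv_nonpos_of_pos (U := fun s => ‖u s‖ ^ 2 - R ^ 2)
    (U' := fun s => 2 * inner ℝ (u s) (G (u s))) ht
    (fun s _ => ((hu s).norm_sq.sub_const _).hasDerivWithinAt) (fun s _ hs => ?_)
  · rw [max_eq_right (by nlinarith [norm_nonneg (u 0)])] at key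
    exact le_of_sq_le_sq (by linarith) hR
  · have : R ≤ ‖u s‖ := le_of_sq_le_sq (by linarith) (norm_nonneg _)
    linarith [hG _ this]

namespace IsConeField

variable {F : E → E} {ξ e : E} {κ r c : ℝ}

/-- A solution that stays in the cone at `ξ` for all negative times issues from `ξ`. -/
theorem tendsto_atBot_of_mem_cone (h : IsConeField F ξ e κ r c) {w : ℝ → E}
    (hw : ∀ s ≤ 0, HasDerivAt w (F (w s)) s) (hcone : ∀ s ≤ 0, coneForm e κ (w s - ξ) ≤ 0)
    (hy : ∀ s ≤ 0, 0 ≤ inner ℝ e (w s - ξ) ∧ inner ℝ e (w s - ξ) ≤ r / 2) :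
    Tendsto w atBot (𝓝 ξ) := by
  have hc := h.drift_pos
  have hr := h.radius_pos
  have hin : ∀ s ≤ 0, w s ∈ Metric.ball ξ r := fun s hs =>
    h.mem_ball (hcone s hs) (abs_le.2 ⟨by linarith [(hy s hs).1], (hy s hs).2⟩)
  have hmono : ∀ s t, s ≤ t → t ≤ 0 → inner ℝ e (w s - ξ) ≤ inner ℝ e (w t - ξ) := by
    intro s t hst ht
    have := h.inner_add_le (m := 0) hst (fun x hx => (hw x (hx.2.trans ht)).hasDerivWithinAt)
      (fun x hx => hin x (hx.2.trans ht)) (fun x hx => hcone x (hx.2.trans ht))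
      (fun x _ => sq_nonneg _)
    simpa using this
  -- From s to 0 the coordinate rises at rate at least c y(s)², yet by at most r/2 in all; hence
  -- y(s)² = O(1/|s|).
  have hbound : ∀ s < 0, ‖w s - ξ‖ ^ 2 ≤ (r / c) * (-s)⁻¹ := by
    intro s hs
    have h1 := h.inner_add_le (m := (inner ℝ e (w s - ξ)) ^ 2) hs.le
      (fun x hx => (hw x hx.2).hasDerivWithinAt)
      (fun x hx => hin x hx.2) (fun x hx => hcone x hx.2)
      (fun x hx => pow_le_pow_left₀ (hy s hs.le).1 (hmono s x hx.1 hx.2) 2)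
    have h2 := h.norm_sq_le (hcone s hs.le)
    have h3 : (inner ℝ e (w s - ξ)) ^ 2 * (c * (-s)) ≤ r / 2 := by
      linarith [(hy s hs.le).1, (hy 0 le_rfl).2]
    have h4 : 0 < c * (-s) := mul_pos hc (by linarith)
    have h5 : (r / c) * (-s)⁻¹ = r / (c * (-s)) := by
      rw [div_eq_mul_inv, div_eq_mul_inv, mul_inv, mul_assoc]
    rw [h5, le_div_iff₀ h4]
    nlinarith
  have hlim : Tendsto (fun s : ℝ => (r / c) * (-s)⁻¹) atBot (𝓝 0) := by
    simpa using (tendsto_inv_atTop_zero.comp tendsto_neg_atBot_atTop).const_mul (r / c)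
  have hsq : Tendsto (fun s => ‖w s - ξ‖ ^ 2) atBot (𝓝 0) :=
    squeeze_zero' (Eventually.of_forall fun s => sq_nonneg _)
      ((eventually_lt_atBot 0).mono hbound) hlim
  rw [tendsto_iff_norm_sub_tendsto_zero]
  simpa [Function.comp_def, Real.sqrt_sq] using (Real.continuous_sqrt.tendsto 0).comp hsq

/-- Existence of a nontrivial entire solution issuing from `ξ`, by shooting from the points
`ξ + η • e` and letting `η → 0`. -/
theorem exists_entire_solution [FiniteDimensional ℝ E] (h : IsConeField F ξ e κ r c)
    (hF : ContDiff ℝ 1 F) {R : ℝ} (hR : ∀ x, R ≤ ‖x‖ → inner ℝ x (F x) ≤ 0) :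
    ∃ w : ℝ → E, (∀ s, HasDerivAt w (F (w s)) s) ∧ Tendsto w atBot (𝓝 ξ) ∧
      (∀ s ≤ 0, w s ∈ Metric.ball ξ r) ∧ inner ℝ e (w 0 - ξ) = r / 2 := by
  have hr := h.radius_pos
  -- The ball of radius S contains the ball where the cone conditions hold, and F points inwards
  -- beyond it; truncation outside it will not affect the solution found.
  set S := max R (‖ξ‖ + r) with hS
  have hSpos : 0 < S := lt_of_lt_of_le (by positivity) (le_max_right _ _)
  obtain ⟨G, K, C, hGK, hGC, hGF, hGa⟩ := exists_bounded_lipschitz_truncation hF hSpos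
  have hballS : ∀ x ∈ Metric.ball ξ r, x ∈ Metric.closedBall (0 : E) S := by
    intro x hx
    rw [mem_closedBall_zero_iff]
    rw [mem_ball_iff_norm] at hx
    have := norm_le_norm_add_norm_sub' x ξ
    exact le_trans (by linarith) (le_max_right R (‖ξ‖ + r))
  have hG0 : G ξ = 0 := by
    rw [hGF ξ (hballS ξ (Metric.mem_ball_self hr)), h.apply_eq_zero]
  choose γ hγ0 hγ using fun x => exists_global_solution hGK hGC x
  have hγc : ∀ x, Continuous (γ x) := fun x =>
    continuous_iff_continuousAt.2 fun t => (hγ x t).continuousAt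
  let η : ℕ → ℝ := fun k => r / 2 * (1 / ((k : ℝ) + 1))
  have hη : ∀ k, 0 < η k := fun k => by positivity
  have hηle : ∀ k, η k ≤ r / 2 := fun k => by
    have : 1 / ((k : ℝ) + 1) ≤ 1 := by
      rw [div_le_one (by positivity)]; linarith [Nat.cast_nonneg (α := ℝ) k]
    exact mul_le_of_le_one_right (by positivity) this
  have hηlim : Tendsto η atTop (𝓝 0) := by
    simpa [η] using (tendsto_one_div_add_atTop_nhds_zero_nat (𝕜 := ℝ)).const_mul (r / 2)
  choose t ht0 hty htc using fun k => h.exists_time_inner_eq (u := γ (ξ + η k • e)) (hη k) (hηle k)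
    (fun s hs => by rw [← hGF _ (hballS _ hs)]; exact hγ _ s) (hγc _) (hγ0 _)
  -- the solutions, shifted in time so that they end at time `0` on the level `r / 2`
  let ω : ℕ → ℝ → E := fun k s => γ (ξ + η k • e) (s + t k)
  have hω : ∀ k s, HasDerivAt (ω k) (G (ω k s)) s := fun k s =>
    (hγ (ξ + η k • e) (s + t k)).comp_add_const s (t k)
  have hωD : ∀ k, ∀ s ∈ Icc (-t k) 0, coneForm e κ (ω k s - ξ) ≤ 0 ∧
      0 ≤ inner ℝ e (ω k s - ξ) ∧ inner ℝ e (ω k s - ξ) ≤ r / 2 := fun k s hs =>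
    htc k (s + t k) ⟨by linarith [hs.1], by linarith [hs.2]⟩
  have hωy : ∀ k, inner ℝ e (ω k 0 - ξ) = r / 2 := fun k => by simpa [ω] using hty k
  -- Since ξ is an equilibrium, distances to it grow at most like exp(Kt): climbing from η to r/2
  -- takes arbitrarily long as η → 0.
  have htlim : Tendsto t atTop atTop := by
    have hlow : ∀ k, r / 2 ≤ η k * Real.exp (K * t k) := fun k => by
      have h1 := dist_le_of_global_solutions hGK (hγ (ξ + η k • e))
        (v := fun _ => ξ) (fun s => by rw [hG0]; exact hasDerivAt_const _ _) (t k)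
      rw [hγ0, dist_eq_norm, dist_eq_norm, add_sub_cancel_left, norm_smul, h.norm_eq_one, mul_one,
        Real.norm_of_nonneg (hη k).le, abs_of_nonneg (ht0 k)] at h1
      have h2 := abs_real_inner_le_norm e (γ (ξ + η k • e) (t k) - ξ)
      rw [h.norm_eq_one, one_mul, hty k, abs_of_pos (by positivity)] at h2
      exact h2.trans h1
    refine tendsto_atTop.2 fun b => ?_
    have hl : Tendsto (fun k => η k * Real.exp (K * b)) atTop (𝓝 0) := by
      simpa using hηlim.mul_const (Real.exp (K * b))
    filter_upwards [hl.eventually (gt_mem_nhds (show (0 : ℝ) < r / 2 by positivity))] with k hk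
    by_contra! hcon
    have h1 : Real.exp (K * t k) ≤ Real.exp (K * b) :=
      Real.exp_le_exp.2 (mul_le_mul_of_nonneg_left hcon.le K.2)
    linarith [hlow k, mul_le_mul_of_nonneg_left h1 (hη k).le]
  have hωball : ∀ k, ω k 0 ∈ Metric.closedBall ξ r := fun k =>
    Metric.ball_subset_closedBall (h.mem_ball (hωD k 0 ⟨by linarith [ht0 k], le_rfl⟩).1
      (by rw [hωy k, abs_of_pos (by positivity)]))
  obtain ⟨q, -, φ, hφ, hq⟩ := (isCompact_closedBall ξ r).tendsto_subseq hωball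
  -- Continuous dependence on the value at time 0 turns convergence of the endpoints into
  -- convergence at each fixed time.
  have hconv : ∀ s, Tendsto (fun k => ω (φ k) s) atTop (𝓝 (γ q s)) := by
    intro s
    rw [tendsto_iff_dist_tendsto_zero]
    have h1 : Tendsto (fun k => dist (ω (φ k) 0) q * Real.exp (K * |s|)) atTop (𝓝 0) := by
      simpa using (tendsto_iff_dist_tendsto_zero.1 hq).mul_const (Real.exp (K * |s|))
    refine squeeze_zero (fun _ => dist_nonneg) (fun k => ?_) h1
    simpa [hγ0] using dist_le_of_global_solutions hGK (hω (φ k)) (hγ q) s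
  have hD : ∀ s ≤ 0, coneForm e κ (γ q s - ξ) ≤ 0 ∧
      0 ≤ inner ℝ e (γ q s - ξ) ∧ inner ℝ e (γ q s - ξ) ≤ r / 2 := by
    intro s hs
    have hcl : IsClosed {x : E | coneForm e κ (x - ξ) ≤ 0 ∧
        0 ≤ inner ℝ e (x - ξ) ∧ inner ℝ e (x - ξ) ≤ r / 2} := by
      have h1 : Continuous fun x : E => inner ℝ e (x - ξ) := by fun_prop
      exact (isClosed_le ((continuous_coneForm e κ).comp (continuous_id.sub continuous_const))
        continuous_const).inter
        ((isClosed_le continuous_const h1).inter (isClosed_le h1 continuous_const))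
    refine hcl.mem_of_tendsto (hconv s) ?_
    filter_upwards [(htlim.comp hφ.tendsto_atTop).eventually_ge_atTop (-s)] with k hk
    exact hωD (φ k) s ⟨by simp only [Function.comp_apply] at hk; linarith, hs⟩
  have hin : ∀ s ≤ 0, γ q s ∈ Metric.ball ξ r := fun s hs =>
    h.mem_ball (hD s hs).1 (abs_le.2 ⟨by linarith [(hD s hs).2.1], (hD s hs).2.2⟩)
  -- The limit never leaves the region where G = F: for s ≤ 0 it is in the ball around ξ, and
  -- afterwards the inward field traps it.
  have hsol : ∀ s, HasDerivAt (γ q) (F (γ q s)) s := by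
    intro s
    have hmem : γ q s ∈ Metric.closedBall (0 : E) S := by
      rcases le_total s 0 with hs | hs
      · exact hballS _ (hin s hs)
      · rw [mem_closedBall_zero_iff]
        refine norm_le_of_inner_nonpos (fun x hx => ?_) (hγ q) hSpos.le
          (mem_closedBall_zero_iff.1 (hballS _ (hin 0 le_rfl))) hs
        obtain ⟨a, ha, hax⟩ := hGa x
        rw [hax, inner_smul_right]
        exact mul_nonpos_of_nonneg_of_nonpos ha (hR x ((le_max_left _ _).trans hx))
    rw [← hGF _ hmem]
    exact hγ q s
  refine ⟨γ q, hsol, h.tendsto_atBot_of_mem_cone (fun s _ => hsol s) (fun s hs => (hD s hs).1)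
    (fun s hs => (hD s hs).2), hin, ?_⟩
  have h1 : Continuous fun x : E => inner ℝ e (x - ξ) := by fun_prop
  refine tendsto_nhds_unique ((h1.tendsto _).comp (hconv 0)) ?_
  simp only [Function.comp_def, hωy]
  exact tendsto_const_nhds

/-- Any two nontrivial solutions issuing from `ξ` agree up to a time translation. -/
theorem exists_eq_translate [FiniteDimensional ℝ E] (h : IsConeField F ξ e κ r c)
    (hF : ContDiff ℝ 1 F) {w : ℝ → E} (hw : ∀ s, HasDerivAt w (F (w s)) s)
    (hwl : Tendsto w atBot (𝓝 ξ)) (hwr : ∀ s ≤ 0, w s ∈ Metric.ball ξ r)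
    (hw0 : 0 < inner ℝ e (w 0 - ξ))
    {I : Set ℝ} (hI : I.OrdConnected) (hIb : ¬ BddBelow I) {v : ℝ → E}
    (hv : ∀ s ∈ I, HasDerivWithinAt v (F (v s)) I s) (hvl : Tendsto v atBot (𝓝 ξ))
    (hvn : ∃ s ∈ I, v s ≠ ξ) : ∃ a : ℝ, ∀ s ∈ I, v s = w (s + a) := by
  have hyc : Continuous fun x : E => inner ℝ e (x - ξ) := by fun_prop
  have hlow : ∀ s ∈ I, Iic s ⊆ I := by
    intro s hs t ht
    obtain ⟨b, hb, hbt⟩ := not_bddBelow_iff.1 hIb t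
    exact hI.out hb hs ⟨hbt.le, ht⟩
  obtain ⟨sn, hsn, hvsn⟩ := hvn
  have hne : ∀ s ∈ I, v s ≠ ξ := by
    intro s hs hvs
    exact hvsn (eqOn_of_hasDerivWithinAt_of_eq hF hI hv (w := fun _ => ξ)
      (fun t _ => by rw [h.apply_eq_zero]; exact hasDerivWithinAt_const _ _ _) hs hvs hsn)
  have hyl : Tendsto (fun s => inner ℝ e (v s - ξ)) atBot (𝓝 0) := by
    simpa [Function.comp_def] using (hyc.tendsto ξ).comp hvl
  -- Up to s₀ the solution is in the ball, its coordinate is below that of w at 0 (needed for the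
  -- intermediate value argument), and s₀ ≤ sn places s₀ in I.
  obtain ⟨s₀, hs₀⟩ := eventually_atBot.1 ((hvl.eventually (Metric.ball_mem_nhds ξ h.radius_pos)).and
    ((hyl.eventually (gt_mem_nhds hw0)).and (eventually_le_atBot sn)))
  have hs₀I : s₀ ∈ I := hlow sn hsn (hs₀ s₀ le_rfl).2.2
  have hvb : ∀ s ≤ s₀, v s ∈ Metric.ball ξ r := fun s hs => (hs₀ s hs).1
  have hvI : ∀ s ≤ s₀, ∀ t ∈ Iic s, HasDerivWithinAt v (F (v t)) (Iic s) t := fun s hs t ht =>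
    (hv t (hlow s₀ hs₀I (le_trans ht hs))).mono (hlow s (hlow s₀ hs₀I hs))
  have hcone : ∀ s ≤ s₀, coneForm e κ (v s - ξ) ≤ 0 := fun s hs =>
    h.coneForm_sub_nonpos_of_tendsto (v := fun _ => ξ) (hvI s hs)
      (fun t _ => by rw [h.apply_eq_zero]; exact hasDerivWithinAt_const _ _ _)
      (fun t ht => hvb t (le_trans ht hs)) (fun _ _ => Metric.mem_ball_self h.radius_pos) hvl
      tendsto_const_nhds
  -- The coordinate is nondecreasing and tends to 0 at -∞.
  have hy0 : 0 ≤ inner ℝ e (v s₀ - ξ) := by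
    refine le_of_tendsto hyl ((eventually_le_atBot s₀).mono fun s hs => ?_)
    have := h.inner_add_le (m := 0) hs
      (fun t ht => (hvI s₀ le_rfl t ht.2).mono Icc_subset_Iic_self)
      (fun t ht => hvb t ht.2) (fun t ht => hcone t ht.2) (fun t _ => sq_nonneg _)
    simpa using this
  have hypos : 0 < inner ℝ e (v s₀ - ξ) := by
    refine hy0.lt_of_ne fun h0 => hne s₀ hs₀I ?_
    exact sub_eq_zero.1 (h.eq_zero_of_inner_eq_zero (hcone s₀ le_rfl) h0.symm)
  -- a time at which `w` has the same coordinate along `e` as `v` at time `s₀`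
  obtain ⟨s₁, hs₁, hs₁y⟩ : ∃ s₁ ≤ 0, inner ℝ e (w s₁ - ξ) = inner ℝ e (v s₀ - ξ) := by
    have hwy : Tendsto (fun s => inner ℝ e (w s - ξ)) atBot (𝓝 0) := by
      simpa [Function.comp_def] using (hyc.tendsto ξ).comp hwl
    obtain ⟨s₂, hs₂, hs₂'⟩ := ((hwy.eventually (gt_mem_nhds hypos)).and
      (eventually_le_atBot 0)).exists
    have hwc : Continuous w := continuous_iff_continuousAt.2 fun t => (hw t).continuousAt
    obtain ⟨s₁, hs₁, hs₁'⟩ := intermediate_value_Icc hs₂' (hyc.comp hwc).continuousOn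
      (show inner ℝ e (v s₀ - ξ) ∈ Icc _ _ from ⟨hs₂.le, (hs₀ s₀ le_rfl).2.1.le⟩)
    exact ⟨s₁, hs₁.2, hs₁'⟩
  have hshift : ∀ s, HasDerivAt (fun t => w (t + (s₁ - s₀))) (F (w (s + (s₁ - s₀)))) s := fun s =>
    (hw (s + (s₁ - s₀))).comp_add_const s (s₁ - s₀)
  refine ⟨s₁ - s₀, eqOn_of_hasDerivWithinAt_of_eq hF hI hv
    (w := fun t => w (t + (s₁ - s₀))) (fun s _ => (hshift s).hasDerivWithinAt) hs₀I ?_⟩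
  have hdiff := h.coneForm_sub_nonpos_of_tendsto (v := fun t => w (t + (s₁ - s₀)))
    (hvI s₀ le_rfl) (fun s _ => (hshift s).hasDerivWithinAt) hvb
    (fun s hs => hwr _ (by have : s ≤ s₀ := hs; linarith)) hvl
    (hwl.comp (tendsto_atBot_add_const_right _ _ tendsto_id))
  refine sub_eq_zero.1 (h.eq_zero_of_inner_eq_zero hdiff ?_)
  have h1 : s₀ + (s₁ - s₀) = s₁ := by ring
  simp only [h1]
  rw [inner_sub_right] at hs₁y ⊢
  rw [inner_sub_right] at hs₁y
  linarith

end IsConeField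

end

/-! ### Cone conditions from the Taylor expansion at ξ -/

section

variable {E : Type*} [NormedAddCommGroup E] [InnerProductSpace ℝ E]

/-- With z the component orthogonal to e and y the coordinate along e, this makes `coneForm e (1 + M
^ 2)` equal to ‖z‖² - M²y². -/
theorem norm_sub_inner_smul_sq {e : E} (he : ‖e‖ = 1) (v : E) :
    ‖v - inner ℝ e v • e‖ ^ 2 = ‖v‖ ^ 2 - (inner ℝ e v) ^ 2 := by
  rw [norm_sub_sq_real, inner_smul_right, norm_smul, he, real_inner_comm, Real.norm_eq_abs,
    mul_one, sq_abs]
  ring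

/-- A quadratic form that is positive in the direction `e` is positive on a thin cone around it. -/
theorem half_mul_sq_le_of_coneForm_nonpos {e : E} (he : ‖e‖ = 1) {B : E →L[ℝ] E →L[ℝ] E}
    {b M : ℝ} (hb : inner ℝ e (B e e) = b) (hM0 : 0 ≤ M) (hM1 : M ≤ 1) (hM : 6 * M * ‖B‖ ≤ b)
    {v : E} (hv : coneForm e (1 + M ^ 2) v ≤ 0) :
    b / 2 * (inner ℝ e v) ^ 2 ≤ inner ℝ e (B v v) := by
  set y := inner ℝ e v with hy
  set z := v - y • e with hz
  have hzsq : ‖z‖ ^ 2 ≤ (M * |y|) ^ 2 := by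
    have := norm_sub_inner_smul_sq he v
    rw [← hy, ← hz] at this
    rw [this, mul_pow, sq_abs]
    unfold coneForm at hv
    rw [← hy] at hv
    linarith
  have hzle : ‖z‖ ≤ M * |y| := le_of_sq_le_sq hzsq (by positivity)
  have hvz : v = y • e + z := by rw [hz]; abel
  have hexp : inner ℝ e (B v v) = y ^ 2 * b + y * inner ℝ e (B e z) + y * inner ℝ e (B z e)
      + inner ℝ e (B z z) := by
    rw [hvz]
    simp only [map_add, map_smul, add_apply, smul_apply, inner_add_right,
      inner_smul_right, ← hb]
    ring
  have hbd : ∀ p q : E, |inner ℝ e (B p q)| ≤ ‖B‖ * ‖p‖ * ‖q‖ := fun p q => by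
    have h1 := abs_real_inner_le_norm e (B p q)
    rw [he, one_mul] at h1
    exact h1.trans (B.le_opNorm₂ p q)
  -- Each of the three terms involving z is at most ‖B‖My²; together they cost at most half of b y²,
  -- because 6M‖B‖ ≤ b.
  have h1 : |y * inner ℝ e (B e z)| ≤ ‖B‖ * M * y ^ 2 := by
    rw [abs_mul]
    calc |y| * |inner ℝ e (B e z)| ≤ |y| * (‖B‖ * ‖e‖ * (M * |y|)) := by
          gcongr; exact (hbd e z).trans (by gcongr)
      _ = ‖B‖ * M * y ^ 2 := by rw [he, ← sq_abs y]; ring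
  have h2 : |y * inner ℝ e (B z e)| ≤ ‖B‖ * M * y ^ 2 := by
    rw [abs_mul]
    calc |y| * |inner ℝ e (B z e)| ≤ |y| * (‖B‖ * (M * |y|) * ‖e‖) := by
          gcongr; exact (hbd z e).trans (by gcongr)
      _ = ‖B‖ * M * y ^ 2 := by rw [he, ← sq_abs y]; ring
  have h3 : |inner ℝ e (B z z)| ≤ ‖B‖ * M * y ^ 2 := by
    calc |inner ℝ e (B z z)| ≤ ‖B‖ * ‖z‖ * ‖z‖ := hbd z z
      _ ≤ ‖B‖ * (M * |y|) * (1 * |y|) := by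
          gcongr; exact hzle.trans (by gcongr)
      _ = ‖B‖ * M * y ^ 2 := by rw [← sq_abs y]; ring
  have h4 := mul_le_mul_of_nonneg_right hM (sq_nonneg y)
  rw [hexp]
  nlinarith [(abs_le.1 h1).1, (abs_le.1 h2).1, (abs_le.1 h3).1]

/-- A `C²` field which vanishes at `ξ`, whose linearization is negative definite transversally to
`e` and degenerate along `e`, and whose second derivative along `e` is positive in the direction
`e`, satisfies the cone conditions near `ξ`. -/
theorem exists_isConeField {F : E → E} (hF : ContDiff ℝ 2 F) {ξ e : E} (he : ‖e‖ = 1)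
    (hF0 : F ξ = 0) {μ : ℝ} (hμ : 0 < μ)
    (hneg : ∀ u, inner ℝ u (fderiv ℝ F ξ u) ≤ -μ * (‖u‖ ^ 2 - (inner ℝ e u) ^ 2))
    (hker : ∀ u, inner ℝ e (fderiv ℝ F ξ u) = 0)
    (hquad : 0 < inner ℝ e (fderiv ℝ (fderiv ℝ F) ξ e e)) :
    ∃ κ r c, IsConeField F ξ e κ r c := by
  set A := fderiv ℝ F ξ with hA
  set B := fderiv ℝ (fderiv ℝ F) ξ with hB
  set b := inner ℝ e (B e e) with hb
  obtain ⟨M, hM0, hM1, hM⟩ : ∃ M : ℝ, 0 < M ∧ M ≤ 1 ∧ 6 * M * ‖B‖ ≤ b := by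
    refine ⟨min 1 (b / (6 * (‖B‖ + 1))), by positivity, min_le_left _ _, ?_⟩
    have h1 : min 1 (b / (6 * (‖B‖ + 1))) * (6 * (‖B‖ + 1)) ≤ b := by
      rw [← le_div_iff₀ (by positivity)]; exact min_le_right _ _
    have h2 : 0 < min 1 (b / (6 * (‖B‖ + 1))) := by positivity
    nlinarith
  have hdF : ∀ x, HasFDerivAt F (fderiv ℝ F x) x := fun x =>
    (hF.differentiable two_ne_zero x).hasFDerivAt
  have hstrict : HasStrictFDerivAt F A ξ := hF.contDiffAt.hasStrictFDerivAt two_ne_zero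
  have hd2 : HasFDerivAt (fderiv ℝ F) B ξ :=
    ((hF.fderiv_right (m := 1) (by norm_num)).differentiable one_ne_zero ξ).hasFDerivAt
  -- Two moving points are compared, so strict differentiability is required. Outside the cone the
  -- linear part gains μM²/2 ‖Δ‖²; the remainder enters with weight 1 + κ ≤ 3, hence the constant
  -- μM²/6.
  obtain ⟨r₁, hr₁, hlip⟩ : ∃ r₁ > 0, ∀ x ∈ Metric.ball ξ r₁, ∀ y ∈ Metric.ball ξ r₁,
      ‖F x - F y - A (x - y)‖ ≤ μ * M ^ 2 / 6 * ‖x - y‖ := by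
    have h1 := hstrict.isLittleO.def (show 0 < μ * M ^ 2 / 6 by positivity)
    obtain ⟨r₁, hr₁, h2⟩ := Metric.eventually_nhds_iff_ball.1 h1
    exact ⟨r₁, hr₁, fun x hx y hy => h2 (x, y) (by rw [← ball_prod_same]; exact ⟨hx, hy⟩)⟩
  -- In the cone ‖v‖² ≤ 2y², so this error takes b/4 from the b/2 of the quadratic term; the
  -- remaining (b/4)ty², integrated over t in [0,1], gives the drift constant b/8.
  obtain ⟨r₂, hr₂, hsec⟩ : ∃ r₂ > 0, ∀ x ∈ Metric.ball ξ r₂,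
      ‖fderiv ℝ F x - A - B (x - ξ)‖ ≤ b / 8 * ‖x - ξ‖ :=
    Metric.eventually_nhds_iff_ball.1 (hd2.isLittleO.def (show 0 < b / 8 by positivity))
  refine ⟨1 + M ^ 2, min r₁ r₂, b / 8, he, by nlinarith, by nlinarith, lt_min hr₁ hr₂,
    by positivity, hF0, ?_, ?_⟩
  · intro x hx y hy hpos
    have hn := hlip x (Metric.ball_subset_ball (min_le_left _ _) hx) y
      (Metric.ball_subset_ball (min_le_left _ _) hy)
    set Δ := x - y with hΔ
    set n := F x - F y - A Δ with hnd
    have hFn : F x - F y = A Δ + n := by rw [hnd]; abel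
    have h1 : inner ℝ Δ n ≤ μ * M ^ 2 / 6 * ‖Δ‖ ^ 2 := by
      calc inner ℝ Δ n ≤ ‖Δ‖ * ‖n‖ := real_inner_le_norm _ _
        _ ≤ ‖Δ‖ * (μ * M ^ 2 / 6 * ‖Δ‖) := by gcongr
        _ = _ := by ring
    have h2 : |inner ℝ e Δ * inner ℝ e n| ≤ μ * M ^ 2 / 6 * ‖Δ‖ ^ 2 := by
      have h3 := abs_real_inner_le_norm e Δ
      have h4 := abs_real_inner_le_norm e n
      rw [he, one_mul] at h3 h4
      rw [abs_mul]
      calc |inner ℝ e Δ| * |inner ℝ e n| ≤ ‖Δ‖ * (μ * M ^ 2 / 6 * ‖Δ‖) := by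
            gcongr; exact h4.trans hn
        _ = _ := by ring
    have h3 : M ^ 2 * ‖Δ‖ ^ 2 ≤ 2 * (‖Δ‖ ^ 2 - (inner ℝ e Δ) ^ 2) := by
      unfold coneForm at hpos
      have hM2 : M ^ 2 ≤ 1 := by nlinarith
      have h4 := mul_le_mul_of_nonneg_left hpos.le (show 0 ≤ 2 - M ^ 2 by linarith)
      have h5 : 0 ≤ M ^ 2 * (1 - M ^ 2) * (inner ℝ e Δ) ^ 2 :=
        mul_nonneg (mul_nonneg (sq_nonneg M) (by linarith)) (sq_nonneg _)
      linarith
    have h4 : -((1 + M ^ 2) * (inner ℝ e Δ * inner ℝ e n)) ≤ 2 * (μ * M ^ 2 / 6 * ‖Δ‖ ^ 2) := by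
      have h5 : -(inner ℝ e Δ * inner ℝ e n) ≤ μ * M ^ 2 / 6 * ‖Δ‖ ^ 2 :=
        (neg_le_abs _).trans h2
      calc -((1 + M ^ 2) * (inner ℝ e Δ * inner ℝ e n))
          = (1 + M ^ 2) * -(inner ℝ e Δ * inner ℝ e n) := by ring
        _ ≤ (1 + M ^ 2) * (μ * M ^ 2 / 6 * ‖Δ‖ ^ 2) := by gcongr
        _ ≤ 2 * (μ * M ^ 2 / 6 * ‖Δ‖ ^ 2) := by gcongr; nlinarith
    have h6 := mul_le_mul_of_nonneg_left h3 hμ.le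
    rw [hFn, inner_add_right, inner_add_right, hker Δ, zero_add]
    linarith [hneg Δ]
  · intro x hx hcone
    set v := x - ξ with hv
    have hvr : ‖v‖ < r₂ := (mem_ball_iff_norm.1 hx).trans_le (min_le_right _ _)
    have hBv := half_mul_sq_le_of_coneForm_nonpos he hb.symm hM0.le hM1 hM hcone
    have hvsq : ‖v‖ ^ 2 ≤ 2 * (inner ℝ e v) ^ 2 := by
      unfold coneForm at hcone
      have hM2 : M ^ 2 ≤ 1 := by nlinarith
      nlinarith [sq_nonneg (inner ℝ e v)]
    have hder : ∀ t : ℝ, HasDerivAt (fun t : ℝ => inner ℝ e (F (ξ + t • v)))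
        (inner ℝ e (fderiv ℝ F (ξ + t • v) v)) t := fun t => by
      have h1 : HasDerivAt (fun t : ℝ => ξ + t • v) v t := by
        simpa using ((hasDerivAt_id t).smul_const v).const_add ξ
      simpa using (hasDerivAt_const t e).inner ℝ ((hdF (ξ + t • v)).comp_hasDerivAt t h1)
    have key := le_max_zero_of_deriv_nonpos_of_pos
      (U := fun t => b / 8 * (inner ℝ e v) ^ 2 * t ^ 2 - inner ℝ e (F (ξ + t • v)))
      (U' := fun t => b / 8 * (inner ℝ e v) ^ 2 * (2 * t) - inner ℝ e (fderiv ℝ F (ξ + t • v) v))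
      zero_le_one (fun t _ => ?_) (fun t ht _ => ?_)
    · have hx1 : ξ + (1 : ℝ) • v = x := by rw [one_smul, hv]; abel
      simp only [hx1, zero_smul, add_zero, hF0, inner_zero_right] at key
      simp at key
      linarith
    · have h1 := ((hasDerivAt_pow 2 t).const_mul (b / 8 * (inner ℝ e v) ^ 2)).sub (hder t)
      refine h1.hasDerivWithinAt.congr_deriv ?_
      simp
    · have htv : ‖t • v‖ = t * ‖v‖ := by rw [norm_smul, Real.norm_of_nonneg ht.1]
      have hmem : ξ + t • v ∈ Metric.ball ξ r₂ := by
        rw [mem_ball_iff_norm, add_sub_cancel_left, htv]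
        nlinarith [ht.1, ht.2, norm_nonneg v]
      have h1 := hsec _ hmem
      rw [add_sub_cancel_left, htv] at h1
      set D := fderiv ℝ F (ξ + t • v) - A - B (t • v) with hD
      have h2 : fderiv ℝ F (ξ + t • v) v = A v + t • B v v + D v := by
        rw [hD]; simp
      have h3 : |inner ℝ e (D v)| ≤ b / 8 * t * ‖v‖ ^ 2 := by
        have h4 := abs_real_inner_le_norm e (D v)
        rw [he, one_mul] at h4
        calc _ ≤ ‖D v‖ := h4
          _ ≤ ‖D‖ * ‖v‖ := D.le_opNorm v
          _ ≤ b / 8 * (t * ‖v‖) * ‖v‖ := by gcongr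
          _ = _ := by ring
      have h5 := (abs_le.1 h3).1
      have h6 := mul_le_mul_of_nonneg_left hBv ht.1
      have h7 : b / 8 * t * ‖v‖ ^ 2 ≤ b / 8 * t * (2 * (inner ℝ e v) ^ 2) := by
        have := ht.1
        gcongr
      rw [h2, inner_add_right, inner_add_right, hker, inner_smul_right]
      linarith

end

/-! ### Gradient, Hessian and cubic form in coordinates -/

section

variable {n : ℕ}

theorem fderiv_apply_eq_sum_partialD (g : EuclideanSpace ℝ (Fin n) → ℝ)
    (x u : EuclideanSpace ℝ (Fin n)) : fderiv ℝ g x u = ∑ i, u i * partialD i g x := by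
  have hu : u = ∑ i, u i • EuclideanSpace.single i (1 : ℝ) := by
    ext j
    simp [Pi.single_apply]
  conv_lhs => rw [hu]
  simp [partialD]

theorem contDiff_partialD {g : EuclideanSpace ℝ (Fin n) → ℝ} {k m : ℕ} (hg : ContDiff ℝ k g)
    (hmk : m + 1 ≤ k) (i : Fin n) : ContDiff ℝ m (partialD i g) :=
  (hg.fderiv_right (by exact_mod_cast hmk)).clm_apply contDiff_const

theorem fderiv_fderiv_apply_eq_sum {g : EuclideanSpace ℝ (Fin n) → ℝ} (hg : ContDiff ℝ 2 g)
    (x u v : EuclideanSpace ℝ (Fin n)) :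
    fderiv ℝ (fun y => fderiv ℝ g y v) x u = ∑ i, ∑ j, u i * v j * hessianMatrix g x i j := by
  have hd : ∀ j, Differentiable ℝ (partialD j g) := fun j =>
    (contDiff_partialD (k := 2) (m := 1) hg le_rfl j).differentiable one_ne_zero
  have h1 : (fun y => fderiv ℝ g y v) = fun y => ∑ j, v j * partialD j g y := by
    funext y; exact fderiv_apply_eq_sum_partialD g y v
  rw [h1, fderiv_fun_sum fun j _ => (hd j x).const_mul (v j)]
  simp_rw [fun j => fderiv_const_mul (hd j x) (v j)]
  simp only [sum_apply, smul_apply, smul_eq_mul,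
    fderiv_apply_eq_sum_partialD _ x u, Finset.mul_sum]
  rw [Finset.sum_comm]
  refine Finset.sum_congr rfl fun i _ => Finset.sum_congr rfl fun j _ => ?_
  simp only [hessianMatrix, Matrix.of_apply]
  ring

theorem fderiv_fderiv_fderiv_apply_eq_cubicTerm {g : EuclideanSpace ℝ (Fin n) → ℝ}
    (hg : ContDiff ℝ 3 g) (x u : EuclideanSpace ℝ (Fin n)) :
    fderiv ℝ (fun z => fderiv ℝ (fun y => fderiv ℝ g y u) z u) x u = cubicTerm g x u := by
  have hg2 : ContDiff ℝ 2 g := hg.of_le (by norm_num)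
  have hd : ∀ i j, Differentiable ℝ (partialD i (partialD j g)) := fun i j =>
    (contDiff_partialD (k := 2) (m := 1) (contDiff_partialD (k := 3) (m := 2) hg le_rfl j)
      le_rfl i).differentiable one_ne_zero
  have h1 : (fun z => fderiv ℝ (fun y => fderiv ℝ g y u) z u) =
      fun z => ∑ i, ∑ j, u i * u j * partialD i (partialD j g) z := by
    funext z; exact fderiv_fderiv_apply_eq_sum hg2 z u u
  have hdd : ∀ i j, DifferentiableAt ℝ (fun z => u i * u j * partialD i (partialD j g) z) x :=
    fun i j => (hd i j x).const_mul _
  rw [h1, fderiv_fun_sum fun i _ => DifferentiableAt.fun_sum fun j _ => hdd i j]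
  simp_rw [fun i => fderiv_fun_sum (u := Finset.univ) fun j _ => hdd i j,
    fun i j => fderiv_const_mul (hd i j x) (u i * u j)]
  simp only [sum_apply, smul_apply, smul_eq_mul,
    fderiv_apply_eq_sum_partialD _ x u, Finset.mul_sum, cubicTerm]
  -- Only summation indices are renamed; symmetry of third derivatives plays no role.
  have h2 : ∀ i, ∑ j, ∑ k, u i * u j * (u k * partialD k (partialD i (partialD j g)) x) =
      ∑ k, ∑ j, partialD k (partialD i (partialD j g)) x * u k * u i * u j := fun i => by
    rw [Finset.sum_comm]
    refine Finset.sum_congr rfl fun k _ => Finset.sum_congr rfl fun j _ => ?_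
    ring
  simp_rw [h2]
  rw [Finset.sum_comm]

/-- The degree is odd, so replacing ℓ by -ℓ makes the cubic form take either sign. -/
theorem cubicTerm_smul (g : EuclideanSpace ℝ (Fin n) → ℝ) (x l : EuclideanSpace ℝ (Fin n))
    (a : ℝ) : cubicTerm g x (a • l) = a ^ 3 * cubicTerm g x l := by
  simp only [cubicTerm, Finset.mul_sum, PiLp.smul_apply, smul_eq_mul]
  refine Finset.sum_congr rfl fun i _ => Finset.sum_congr rfl fun j _ =>
    Finset.sum_congr rfl fun k _ => ?_
  ring

theorem inner_gradient_eq_fderiv (g : EuclideanSpace ℝ (Fin n) → ℝ)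
    (x u : EuclideanSpace ℝ (Fin n)) : inner ℝ (gradient g x) u = fderiv ℝ g x u := by
  simp [gradient]

theorem contDiff_gradient {g : EuclideanSpace ℝ (Fin n) → ℝ} {k m : ℕ} (hg : ContDiff ℝ k g)
    (hmk : m + 1 ≤ k) : ContDiff ℝ m (gradient g) :=
  (InnerProductSpace.toDual ℝ (EuclideanSpace ℝ (Fin n))).symm.contDiff.comp
    (hg.fderiv_right (by exact_mod_cast hmk))

theorem inner_fderiv_gradient {g : EuclideanSpace ℝ (Fin n) → ℝ} (hg : ContDiff ℝ 2 g)
    (x u v : EuclideanSpace ℝ (Fin n)) :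
    inner ℝ v (fderiv ℝ (gradient g) x u) = fderiv ℝ (fun y => fderiv ℝ g y v) x u := by
  have hd : HasFDerivAt (gradient g) (fderiv ℝ (gradient g) x) x :=
    ((contDiff_gradient (k := 2) (m := 1) hg le_rfl).differentiable one_ne_zero x).hasFDerivAt
  have h1 : (fun y => fderiv ℝ g y v) = fun y => innerSL ℝ v (gradient g y) := by
    funext y
    rw [← inner_gradient_eq_fderiv, real_inner_comm]; rfl
  have h2 : HasFDerivAt (fun y => innerSL ℝ v (gradient g y)) _ x :=
    (innerSL ℝ v).hasFDerivAt.comp x hd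
  rw [h1, h2.fderiv]
  rfl

theorem inner_fderiv_fderiv_gradient {g : EuclideanSpace ℝ (Fin n) → ℝ} (hg : ContDiff ℝ 3 g)
    (x u : EuclideanSpace ℝ (Fin n)) :
    inner ℝ u (fderiv ℝ (fderiv ℝ (gradient g)) x u u) = cubicTerm g x u := by
  rw [← fderiv_fderiv_fderiv_apply_eq_cubicTerm hg]
  let Λ : (EuclideanSpace ℝ (Fin n) →L[ℝ] EuclideanSpace ℝ (Fin n)) →L[ℝ] ℝ :=
    (innerSL ℝ u).comp (ContinuousLinearMap.apply ℝ (EuclideanSpace ℝ (Fin n)) u)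
  have h1 : (fun z => fderiv ℝ (fun y => fderiv ℝ g y u) z u) =
      fun z => Λ (fderiv ℝ (gradient g) z) := by
    funext z
    exact (inner_fderiv_gradient (hg.of_le (by norm_num)) z u u).symm
  have hd : HasFDerivAt (fderiv ℝ (gradient g)) (fderiv ℝ (fderiv ℝ (gradient g)) x) x :=
    (((contDiff_gradient (k := 3) (m := 2) hg le_rfl).fderiv_right (m := 1)
      (by norm_num)).differentiable one_ne_zero x).hasFDerivAt
  have h2 : HasFDerivAt (fun z => Λ (fderiv ℝ (gradient g) z)) _ x := Λ.hasFDerivAt.comp x hd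
  rw [h1, h2.fderiv]
  rfl

/-- The coordinate formula produces the transposed Hessian; `hH`, available from positive
semidefiniteness, identifies the two. -/
theorem fderiv_gradient_eq_toEuclideanLin {g : EuclideanSpace ℝ (Fin n) → ℝ}
    (hg : ContDiff ℝ 2 g) {x : EuclideanSpace ℝ (Fin n)} (hH : (hessianMatrix g x).IsHermitian)
    (u : EuclideanSpace ℝ (Fin n)) :
    fderiv ℝ (gradient g) x u = Matrix.toEuclideanLin (hessianMatrix g x) u := by
  refine ext_inner_left ℝ fun v => ?_
  rw [inner_fderiv_gradient hg, fderiv_fderiv_apply_eq_sum hg, Finset.sum_comm]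
  simp only [PiLp.inner_apply, Matrix.toLpLin_apply, Matrix.mulVec, dotProduct,
    RCLike.inner_apply, conj_trivial, Finset.sum_mul]
  refine Finset.sum_congr rfl fun i _ => Finset.sum_congr rfl fun j _ => ?_
  have : hessianMatrix g x j i = hessianMatrix g x i j := by simpa using hH.apply i j
  rw [this]
  ring

/-- A positive semidefinite matrix is bounded below by a positive multiple of the squared norm
transversally to its kernel, when the latter is the line spanned by a unit vector. -/
theorem Matrix.PosSemidef.exists_pos_mul_le_inner {H : Matrix (Fin n) (Fin n) ℝ}
    (hH : H.PosSemidef) {e : EuclideanSpace ℝ (Fin n)} (he : ‖e‖ = 1)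
    (hker : LinearMap.ker (Matrix.toEuclideanLin H) = Submodule.span ℝ {e}) :
    ∃ μ > 0, ∀ u, μ * (‖u‖ ^ 2 - (inner ℝ e u) ^ 2) ≤ inner ℝ u (Matrix.toEuclideanLin H u) := by
  set A := Matrix.toEuclideanLin H with hA
  have hinner : ∀ u, inner ℝ u (A u) = dotProduct (star u.ofLp) (H.mulVec u.ofLp) := fun u => by
    rw [hA, Matrix.toLpLin_apply, EuclideanSpace.inner_eq_star_dotProduct, dotProduct_comm]
  have hnonneg : ∀ u, 0 ≤ inner ℝ u (A u) := fun u => by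
    rw [hinner]; exact hH.dotProduct_mulVec_nonneg _
  have hzero : ∀ u, inner ℝ u (A u) = 0 → A u = 0 := fun u hu => by
    rw [hinner, hH.dotProduct_mulVec_zero_iff] at hu
    rw [hA, Matrix.toLpLin_apply, hu]; rfl
  have hAe : A e = 0 := by
    rw [← LinearMap.mem_ker, hker]; exact Submodule.mem_span_singleton_self e
  have hsymm : ∀ u v, inner ℝ (A u) v = inner ℝ u (A v) :=
    Matrix.isSymmetric_toEuclideanLin_iff.2 hH.isHermitian
  have hAc : Continuous fun u => inner ℝ u (A u) :=
    continuous_id.inner A.continuous_of_finiteDimensional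
  have hcomp : IsCompact (Metric.sphere (0 : EuclideanSpace ℝ (Fin n)) 1 ∩
      {u | inner ℝ e u = 0}) :=
    (isCompact_sphere 0 1).inter_right (isClosed_eq (by fun_prop) continuous_const)
  -- μ is the minimum of the form on unit vectors orthogonal to e. It is positive because a zero of
  -- a semidefinite form lies in the kernel, here the line of e. In dimension one there are no such
  -- vectors and any μ works.
  obtain ⟨μ, hμ, hμle⟩ : ∃ μ > 0, ∀ u, ‖u‖ = 1 → inner ℝ e u = 0 → μ ≤ inner ℝ u (A u) := by
    rcases (Metric.sphere (0 : EuclideanSpace ℝ (Fin n)) 1 ∩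
      {u | inner ℝ e u = 0}).eq_empty_or_nonempty with hem | hne
    · refine ⟨1, one_pos, fun u hu hu' => ?_⟩
      have : u ∈ (∅ : Set (EuclideanSpace ℝ (Fin n))) := hem ▸ ⟨by simpa using hu, hu'⟩
      exact this.elim
    · obtain ⟨u₀, ⟨hu₀, hu₀' : inner ℝ e u₀ = 0⟩, hmin⟩ := hcomp.exists_isMinOn hne hAc.continuousOn
      refine ⟨inner ℝ u₀ (A u₀), (hnonneg u₀).lt_of_ne fun h0 => ?_, fun u hu hu' =>
        hmin ⟨by simpa using hu, hu'⟩⟩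
      have hmem : u₀ ∈ Submodule.span ℝ {e} := by
        rw [← hker, LinearMap.mem_ker]; exact hzero u₀ h0.symm
      obtain ⟨a, rfl⟩ := Submodule.mem_span_singleton.1 hmem
      rw [inner_smul_right, real_inner_self_eq_norm_sq, he] at hu₀'
      have ha : a = 0 := by simpa using hu₀'
      simp [ha] at hu₀
  refine ⟨μ, hμ, fun u => ?_⟩
  set z := u - inner ℝ e u • e with hz
  have hez : inner ℝ e z = 0 := by
    rw [hz, inner_sub_right, inner_smul_right, real_inner_self_eq_norm_sq, he]; ring
  have hAz : A z = A u := by rw [hz, map_sub, map_smul, hAe]; simp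
  have huz : inner ℝ u (A u) = inner ℝ z (A z) := by
    rw [hAz, hz, inner_sub_left, inner_smul_left, ← hsymm e, hAe]; simp
  rw [huz, ← norm_sub_inner_smul_sq he, ← hz]
  rcases eq_or_ne z 0 with h0 | h0
  · simp [h0]
  · have hnz : ‖z‖ ≠ 0 := norm_ne_zero_iff.2 h0
    have h1 := hμle (‖z‖⁻¹ • z) (by rw [norm_smul, norm_inv, norm_norm, inv_mul_cancel₀ hnz])
      (by rw [inner_smul_right, hez, mul_zero])
    rw [map_smul, inner_smul_left, inner_smul_right] at h1
    have h2 : ‖z‖ ^ 2 * (‖z‖⁻¹ * (‖z‖⁻¹ * inner ℝ z (A z))) = inner ℝ z (A z) := by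
      field_simp
    have h3 := mul_le_mul_of_nonneg_left h1 (sq_nonneg ‖z‖)
    simp only [conj_trivial] at h3
    linarith

end
-- The gradient flow of f(τ,·)
theorem mainTheorem2 {n : ℕ} {T : ℝ} (hT : 0 < T)
    (f : ℝ → EuclideanSpace ℝ (Fin n) → ℝ) (hf : IsCoerciveC3 T f)
    (τ : ℝ) (ξ : EuclideanSpace ℝ (Fin n)) (hZ : (τ, ξ) ∈ degenerateSet T f)
    (hpos : (hessianMatrix (f τ) ξ).PosSemidef)
    (l : EuclideanSpace ℝ (Fin n)) (hl : l ≠ 0)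
    (ha : LinearMap.ker (Matrix.toEuclideanLin (hessianMatrix (f τ) ξ)) = Submodule.span ℝ {l})
    (hc : cubicTerm (f τ) ξ l ≠ 0) :
    ∃ w : ℝ → EuclideanSpace ℝ (Fin n),
      IsSolutionIssuingFrom (f τ) ξ univ w ∧
      ∀ (I : Set ℝ) (v : ℝ → EuclideanSpace ℝ (Fin n)),
        IsSolutionIssuingFrom (f τ) ξ I v → ∃ c : ℝ, ∀ s ∈ I, v s = w (s + c) := by
  obtain ⟨hC3, a₀, c₀, ha₀, hc₀, hcoer⟩ := hf
  obtain ⟨hτ : τ ∈ Icc 0 T, hgrad : gradient (f τ) ξ = 0, -⟩ := hZ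
  have hg : ContDiff ℝ 3 (f τ) := by
    rw [← contDiffOn_univ]
    exact hC3.comp (t := Icc 0 T ×ˢ univ) (contDiff_prodMk_right τ).contDiffOn
      fun x _ => ⟨hτ, mem_univ x⟩
  have hg2 : ContDiff ℝ 2 (f τ) := hg.of_le (by norm_num)
  -- Negative, because F = -∇f must have positive second derivative along e.
  obtain ⟨a, ha0, he, hcub⟩ : ∃ a : ℝ, a ≠ 0 ∧ ‖a • l‖ = 1 ∧ cubicTerm (f τ) ξ (a • l) < 0 := by
    have hl' : 0 < ‖l‖ := norm_pos_iff.2 hl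
    rcases hc.lt_or_gt with h | h
    · refine ⟨‖l‖⁻¹, by positivity, ?_, ?_⟩
      · rw [norm_smul, norm_inv, norm_norm, inv_mul_cancel₀ hl'.ne']
      · rw [cubicTerm_smul]
        exact mul_neg_of_pos_of_neg (by positivity) h
    · refine ⟨-‖l‖⁻¹, by simpa using hl, ?_, ?_⟩
      · rw [norm_smul, norm_neg, norm_inv, norm_norm, inv_mul_cancel₀ hl'.ne']
      · rw [cubicTerm_smul]
        have : 0 < (‖l‖⁻¹) ^ 3 := by positivity
        nlinarith
  set e := a • l with hedef
  have hker : LinearMap.ker (Matrix.toEuclideanLin (hessianMatrix (f τ) ξ)) =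
      Submodule.span ℝ {e} := by
    rw [ha, hedef, Submodule.span_singleton_smul_eq (IsUnit.mk0 a ha0)]
  obtain ⟨μ, hμ, hμle⟩ := hpos.exists_pos_mul_le_inner he hker
  have hF : ContDiff ℝ 2 fun x => -gradient (f τ) x :=
    (contDiff_gradient (k := 3) (m := 2) hg le_rfl).neg
  have hdF : fderiv ℝ (fun x => -gradient (f τ) x) = fun x => -fderiv ℝ (gradient (f τ)) x := by
    funext x; exact fderiv_fun_neg
  have hH := fun u => fderiv_gradient_eq_toEuclideanLin hg2 hpos.isHermitian u
  obtain ⟨κ, r, c, h⟩ := exists_isConeField hF he (by rw [hgrad, neg_zero]) hμ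
    (fun u => by
      rw [hdF]
      simp only [neg_apply, inner_neg_right, hH]
      linarith [hμle u])
    (fun u => by
      rw [hdF]
      simp only [neg_apply, inner_neg_right, hH]
      have hAe : Matrix.toEuclideanLin (hessianMatrix (f τ) ξ) e = 0 := by
        rw [← LinearMap.mem_ker, hker]; exact Submodule.mem_span_singleton_self e
      rw [← Matrix.isSymmetric_toEuclideanLin_iff.2 hpos.isHermitian e u, hAe]
      simp)
    (by
      rw [hdF, fderiv_fun_neg]
      simp only [neg_apply, inner_neg_right]
      rw [inner_fderiv_fderiv_gradient hg]
      linarith)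
  have hF1 : ContDiff ℝ 1 fun x => -gradient (f τ) x := hF.of_le (by norm_num)
  -- Beyond this radius c₀‖x‖² - a₀ ≥ 0, so coercivity makes the field point inwards.
  have hinw : ∀ x : EuclideanSpace ℝ (Fin n), √(a₀ / c₀) ≤ ‖x‖ →
      inner ℝ x (-gradient (f τ) x) ≤ 0 := by
    intro x hx
    rw [Real.sqrt_le_left (norm_nonneg x), div_le_iff₀ hc₀] at hx
    have := hcoer τ hτ x
    rw [inner_neg_right, real_inner_comm]
    linarith
  obtain ⟨w, hw, hwl, hwr, hw0⟩ := h.exists_entire_solution hF1 hinw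
  have hw0' : 0 < inner ℝ e (w 0 - ξ) := by rw [hw0]; linarith [h.radius_pos]
  refine ⟨w, ⟨ordConnected_univ, not_bddBelow_univ, fun s _ => (hw s).hasDerivWithinAt, hwl, 0,
    mem_univ _, fun h0 => ?_⟩, fun I v hv => ?_⟩
  · rw [h0] at hw0'
    simp at hw0'
  · exact h.exists_eq_translate hF1 hw hwl hwr hw0' hv.ordConnected hv.not_bddBelow hv.ode
      hv.tendsto hv.nontrivial
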